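/- Let $T\subset\mathbb R^3$ be a non-degenerate (closed) triangle with vertices $p_1,p_2,p_3$, indices being understood cyclically modulo $3$, and put $\mathbf s_i=p_{i-1}-p_{i+1}$ (the side opposite to $p_i$, running from $p_{i+1}$ to $p_{i-1}$), $\hat{\mathbf s}_i=\mathbf s_i/|\mathbf s_i|$, $\hat{\mathbf w}=(\mathbf s_1\times\mathbf s_2)/|\mathbf s_1\times\mathbf s_2|$ and $\hat{\mathbf m}_i=\hat{\mathbf s}_i\times\hat{\mathbf w}$ for $i=1,2,3$. Let $r_0\in\mathbb R^3$ be a point not in the plane of $T$, and write $r_0=\rho-w_0\hat{\mathbf w}$, where $\rho$ is the orthogonal projection of $r_0$ onto the plane of $T$ and $w_0=(p_1-r_0)\cdot\hat{\mathbf w}\neq0$. For $i=1,2,3$ let $$t_i^0=(p_{i+1}-\rho)\cdot\hat{\mathbf m}_i,\qquad s_i^-=(p_{i+1}-\rho)\cdot\hat{\mathbf s}_i,\qquad s_i^+=(p_{i-1}-\rho)\cdot\hat{\mathbf s}_i,$$ $$R_i^0=\sqrt{(t_i^0)^2+w_0^2},\qquad R_i^\pm=\sqrt{(s_i^\pm)^2+(t_i^0)^2+w_0^2},\qquad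 R_i^s=\frac1{(R_i^0)^2}\left(\frac{s_i^+}{R_i^+}-\frac{s_i^-}{R_i^-}\right),$$ $$\beta_i=\arctan\frac{t_i^0s_i^+}{(R_i^0)^2+|w_0|R_i^+}-\arctan\frac{t_i^0s_i^-}{(R_i^0)^2+|w_0|R_i^-},\qquad \beta=\beta_1+\beta_2+\beta_3,$$ where $\arctan$ is the principal branch, with values in $(-\pi/2,\pi/2)$. With $R=|r-r_0|$ and $dT$ the surface (area) measure on $T$, the function $R^{-5}$ is integrable over $T$ and $$\int_T\frac{dT}{R^5}=\frac13\left(\frac{\beta}{|w_0|^3}+\sum_{i=1}^3\frac{t_i^0}{w_0^2}R_i^s\right).$$ This holds wherever the projection $\rho$ lies: inside $T$, outside $T$, on a side, or at a vertex. -/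

import Mathlib

open MeasureTheory
open scoped Matrix

noncomputable section

namespace TriangleIntegral

/-- Euclidean three-dimensional space. -/
abbrev E3 : Type := EuclideanSpace ℝ (Fin 3)

/-- The cross product on Euclidean space. -/
def cross (a b : E3) : E3 := WithLp.toLp 2 (a.ofLp ⨯₃ b.ofLp)

/-- The unit vector in the direction of `a`. -/
def unit (a : E3) : E3 := ‖a‖⁻¹ • a

/-- The triangle as a closed planar region of space. -/
def region (T : Affine.Triangle ℝ E3) : Set E3 := convexHull ℝ (Set.range T.points)

/-- The edge vector `s i = p (i - 1) - p (i + 1)` opposite to the vertex `p i`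
(the indices `0, 1, 2` are cyclic). -/
def edge (T : Affine.Triangle ℝ E3) (i : Fin 3) : E3 := T.points (i - 1) - T.points (i + 1)

/-- The unit edge direction. -/
def sHat (T : Affine.Triangle ℝ E3) (i : Fin 3) : E3 := unit (edge T i)

/-- The unit normal of the plane of the triangle. -/
def wHat (T : Affine.Triangle ℝ E3) : E3 := unit (cross (edge T 0) (edge T 1))

/-- The unit normal of the `i`-th edge in the plane of the triangle, pointing outwards. -/
def mHat (T : Affine.Triangle ℝ E3) (i : Fin 3) : E3 := cross (sHat T i) (wHat T)

/-- The signed height `w₀`, so that `r₀ = ρ - w₀ ŵ` with `ρ` in the plane of the triangle. -/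
def w0 (T : Affine.Triangle ℝ E3) (r0 : E3) : ℝ := inner ℝ (T.points 0 - r0) (wHat T)

/-- The orthogonal projection `ρ` of `r₀` onto the plane of the triangle. -/
def rho (T : Affine.Triangle ℝ E3) (r0 : E3) : E3 := r0 + w0 T r0 • wHat T

/-- The signed distance `tᵢ⁰` from `ρ` to the line carrying the `i`-th edge: the foot of the
perpendicular is `ρ + tᵢ⁰ m̂ᵢ`. -/
def t0 (T : Affine.Triangle ℝ E3) (r0 : E3) (i : Fin 3) : ℝ :=
  inner ℝ (T.points (i + 1) - rho T r0) (mHat T i)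

/-- The arc-length coordinate `sᵢ⁻` of the starting point `p (i + 1)` of the `i`-th edge, measured
from the foot of the perpendicular in the direction `ŝᵢ`. -/
def sMinus (T : Affine.Triangle ℝ E3) (r0 : E3) (i : Fin 3) : ℝ :=
  inner ℝ (T.points (i + 1) - rho T r0) (sHat T i)

/-- The arc-length coordinate `sᵢ⁺` of the end point `p (i - 1)` of the `i`-th edge, measured
from the foot of the perpendicular in the direction `ŝᵢ`. -/
def sPlus (T : Affine.Triangle ℝ E3) (r0 : E3) (i : Fin 3) : ℝ :=
  inner ℝ (T.points (i - 1) - rho T r0) (sHat T i)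

/-- `Rᵢ⁰`, the distance from `r₀` to the line carrying the `i`-th edge. -/
def R0 (T : Affine.Triangle ℝ E3) (r0 : E3) (i : Fin 3) : ℝ :=
  Real.sqrt (t0 T r0 i ^ 2 + w0 T r0 ^ 2)

/-- `Rᵢ⁻`, the distance from `r₀` to the starting point of the `i`-th edge. -/
def RMinus (T : Affine.Triangle ℝ E3) (r0 : E3) (i : Fin 3) : ℝ :=
  Real.sqrt (sMinus T r0 i ^ 2 + t0 T r0 i ^ 2 + w0 T r0 ^ 2)

/-- `Rᵢ⁺`, the distance from `r₀` to the end point of the `i`-th edge. -/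
def RPlus (T : Affine.Triangle ℝ E3) (r0 : E3) (i : Fin 3) : ℝ :=
  Real.sqrt (sPlus T r0 i ^ 2 + t0 T r0 i ^ 2 + w0 T r0 ^ 2)

/-- The edge function `Rᵢˢ`. -/
def Rs (T : Affine.Triangle ℝ E3) (r0 : E3) (i : Fin 3) : ℝ :=
  1 / R0 T r0 i ^ 2 * (sPlus T r0 i / RPlus T r0 i - sMinus T r0 i / RMinus T r0 i)

/-- The edge term `βᵢ`, with the principal branch of the arctangent. -/
def betaEdge (T : Affine.Triangle ℝ E3) (r0 : E3) (i : Fin 3) : ℝ :=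
  Real.arctan (t0 T r0 i * sPlus T r0 i / (R0 T r0 i ^ 2 + |w0 T r0| * RPlus T r0 i)) -
    Real.arctan (t0 T r0 i * sMinus T r0 i / (R0 T r0 i ^ 2 + |w0 T r0| * RMinus T r0 i))

/-- `β = β₁ + β₂ + β₃`. -/
def beta (T : Affine.Triangle ℝ E3) (r0 : E3) : ℝ := ∑ i : Fin 3, betaEdge T r0 i

end TriangleIntegral

end

/-!
Let `d = |w₀|` and let `g` be the smooth function on `q > 0` with
`(q - d²) g(q) = (d⁻³ - q ^ (-3/2)) / 3`. In the plane of the triangle the vector field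
`g(R²) (x - ρ)` is smooth, because `R ≥ d > 0`, and its divergence is `R⁻⁵`. By the divergence
theorem the integral is the flux through the three sides. On the `i`-th side the outward normal
component of `x - ρ` is the constant `tᵢ⁰`, so the flux is `tᵢ⁰ ∫ g(s² + (tᵢ⁰)² + w₀²) ds` over
`[sᵢ⁻, sᵢ⁺]`, and the integrand has an explicit primitive, which produces the arctangents and `Rᵢˢ`.
The signs of the `tᵢ⁰` account for every position of `ρ`.

The divergence theorem is applied in the affine coordinates `z` with
`x = p₀ + z.1 (p₁ - p₀) + z.2 (p₂ - p₀)`. There the side opposite to `p i` has as its weight the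
barycentric coordinate of `ρ` at `p i`, which is `tᵢ⁰ |sᵢ|` divided by the Jacobian `|s₁ × s₂|`.
-/

noncomputable section

namespace TriangleIntegral

section StandardTriangle

variable {E : Type*} [NormedAddCommGroup E]

/-- The closed triangle with vertices `(0, 0)`, `(1, 0)` and `(0, 1)`: the parameter domain over
which integrals on a triangle in space are computed. -/
def stdTriangle : Set (ℝ × ℝ) := {z | 0 ≤ z.1 ∧ 0 ≤ z.2 ∧ z.1 + z.2 ≤ 1}

theorem isClosed_stdTriangle : IsClosed stdTriangle :=
  (isClosed_le continuous_const continuous_fst).inter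
    ((isClosed_le continuous_const continuous_snd).inter
      (isClosed_le (continuous_fst.add continuous_snd) continuous_const))

theorem isCompact_stdTriangle : IsCompact stdTriangle :=
  (isCompact_Icc (a := ((0 : ℝ), (0 : ℝ))) (b := (1, 1))).of_isClosed_subset isClosed_stdTriangle
    fun _ ⟨h₁, h₂, h⟩ => ⟨⟨h₁, h₂⟩, ⟨by linarith, by linarith⟩⟩

theorem preimage_swap_stdTriangle : Prod.swap ⁻¹' stdTriangle = stdTriangle := by
  ext z
  exact ⟨fun ⟨h₁, h₂, h⟩ => ⟨h₂, h₁, add_comm z.2 z.1 ▸ h⟩,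
    fun ⟨h₁, h₂, h⟩ => ⟨h₂, h₁, add_comm z.1 z.2 ▸ h⟩⟩

theorem indicator_stdTriangle_mk (F : ℝ × ℝ → E) (u v : ℝ) :
    stdTriangle.indicator F (u, v) = (Set.Icc 0 1).indicator
      (fun u => (Set.Icc 0 (1 - u)).indicator (fun v => F (u, v)) v) u := by
  simp only [Set.indicator, ← ite_and]
  congr 1
  simp only [stdTriangle, Set.mem_ofPred_eq, Set.mem_Icc, eq_iff_iff]
  grind

theorem integrableOn_stdTriangle {F : ℝ × ℝ → E} (hF : Continuous F) :
    IntegrableOn F stdTriangle :=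
  hF.continuousOn.integrableOn_compact isCompact_stdTriangle

variable [NormedSpace ℝ E]

theorem setIntegral_stdTriangle {F : ℝ × ℝ → E} (hF : IntegrableOn F stdTriangle) :
    ∫ z in stdTriangle, F z = ∫ u in (0 : ℝ)..1, ∫ v in (0 : ℝ)..(1 - u), F (u, v) := by
  have hmeas := isClosed_stdTriangle.measurableSet
  have hint := hF.integrable_indicator hmeas
  rw [Measure.volume_eq_prod] at hint
  have hslice (u : ℝ) : ∫ v, stdTriangle.indicator F (u, v) =
      (Set.Icc 0 1).indicator (fun u => ∫ v in Set.Icc 0 (1 - u), F (u, v)) u := by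
    by_cases hu : u ∈ Set.Icc (0 : ℝ) 1 <;>
      simp [indicator_stdTriangle_mk, hu, integral_indicator measurableSet_Icc]
  rw [← integral_indicator hmeas, Measure.volume_eq_prod, integral_prod _ hint]
  simp only [hslice]
  rw [integral_indicator measurableSet_Icc, intervalIntegral.integral_of_le zero_le_one,
    ← integral_Icc_eq_integral_Ioc]
  refine setIntegral_congr_fun measurableSet_Icc fun u hu => ?_
  rw [intervalIntegral.integral_of_le (sub_nonneg.2 hu.2), integral_Icc_eq_integral_Ioc]

theorem setIntegral_stdTriangle_swap (F : ℝ × ℝ → E) :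
    ∫ z in stdTriangle, F z.swap = ∫ z in stdTriangle, F z := by
  have h := (Measure.measurePreserving_swap (μ := (volume : Measure ℝ))
    (ν := (volume : Measure ℝ))).setIntegral_preimage_emb
    MeasurableEquiv.prodComm.measurableEmbedding F stdTriangle
  rwa [preimage_swap_stdTriangle, ← Measure.volume_eq_prod] at h

variable [CompleteSpace E]

theorem setIntegral_stdTriangle_fderiv_snd {Q : ℝ × ℝ → E} (hQ : ContDiff ℝ 1 Q) :
    ∫ z in stdTriangle, fderiv ℝ Q z (0, 1) =
      (∫ τ in (0 : ℝ)..1, Q (1 - τ, τ)) - ∫ τ in (0 : ℝ)..1, Q (τ, 0) := by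
  have hQ' : Continuous fun z => fderiv ℝ Q z (0, 1) := by fun_prop
  have hcont := hQ.continuous
  have hderiv (u v : ℝ) : HasDerivAt (fun y => Q (u, y)) (fderiv ℝ Q (u, v) (0, 1)) v :=
    (hQ.differentiable one_ne_zero (u, v)).hasFDerivAt.comp_hasDerivAt v
      ((hasDerivAt_const v u).prodMk (hasDerivAt_id v))
  have hfiber (u : ℝ) : ∫ v in (0 : ℝ)..(1 - u), fderiv ℝ Q (u, v) (0, 1) =
      Q (u, 1 - u) - Q (u, 0) :=
    intervalIntegral.integral_eq_sub_of_hasDerivAt (fun v _ => hderiv u v)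
      (Continuous.intervalIntegrable (by fun_prop) _ _)
  have hflip := intervalIntegral.integral_comp_sub_left (a := 0) (b := 1)
    (fun τ => Q (1 - τ, τ)) 1
  simp only [sub_sub_cancel, sub_self, sub_zero] at hflip
  rw [setIntegral_stdTriangle (integrableOn_stdTriangle hQ'), ← hflip,
    ← intervalIntegral.integral_sub (Continuous.intervalIntegrable (by fun_prop) _ _)
      (Continuous.intervalIntegrable (by fun_prop) _ _)]
  simp only [hfiber]

theorem setIntegral_stdTriangle_fderiv_fst {P : ℝ × ℝ → E} (hP : ContDiff ℝ 1 P) :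
    ∫ z in stdTriangle, fderiv ℝ P z (1, 0) =
      (∫ τ in (0 : ℝ)..1, P (1 - τ, τ)) - ∫ τ in (0 : ℝ)..1, P (0, τ) := by
  have hderiv (z : ℝ × ℝ) :
      fderiv ℝ (fun z => P z.swap) z (0, 1) = fderiv ℝ P z.swap (1, 0) := by
    have h := (hP.differentiable one_ne_zero z.swap).hasFDerivAt.comp z
      (ContinuousLinearEquiv.prodComm ℝ ℝ ℝ).hasFDerivAt
    exact congrArg (fun L => L (0, 1)) h.fderiv
  have hflip := intervalIntegral.integral_comp_sub_left (a := 0) (b := 1)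
    (fun τ => P (1 - τ, τ)) 1
  simp only [sub_sub_cancel, sub_self, sub_zero] at hflip
  rw [← hflip, ← setIntegral_stdTriangle_swap]
  simpa only [hderiv, Prod.swap_prod_mk] using
    setIntegral_stdTriangle_fderiv_snd (Q := fun z => P z.swap)
      (hP.comp (ContinuousLinearEquiv.prodComm ℝ ℝ ℝ).contDiff)

/-- The divergence theorem for the vector field `F(z) (z - z₀)`: along each side the normal
component of `z - z₀` is constant, and this constant gives the weight of that side. -/
theorem setIntegral_stdTriangle_two_smul_add_fderiv {F : ℝ × ℝ → E} (hF : ContDiff ℝ 1 F)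
    (z₀ : ℝ × ℝ) :
    ∫ z in stdTriangle, ((2 : ℝ) • F z + fderiv ℝ F z (z - z₀)) =
      (1 - z₀.1 - z₀.2) • (∫ τ in (0 : ℝ)..1, F (1 - τ, τ)) +
        z₀.1 • (∫ τ in (0 : ℝ)..1, F (0, τ)) + z₀.2 • ∫ τ in (0 : ℝ)..1, F (τ, 0) := by
  set P : ℝ × ℝ → E := fun z => (z.1 - z₀.1) • F z with hPdef
  set Q : ℝ × ℝ → E := fun z => (z.2 - z₀.2) • F z with hQdef
  have hP : ContDiff ℝ 1 P := by fun_prop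
  have hQ : ContDiff ℝ 1 Q := by fun_prop
  have hcont := hF.continuous
  have hdiv (z : ℝ × ℝ) : (2 : ℝ) • F z + fderiv ℝ F z (z - z₀) =
      fderiv ℝ P z (1, 0) + fderiv ℝ Q z (0, 1) := by
    have hF' := (hF.differentiable one_ne_zero z).hasFDerivAt
    have hsplit : z - z₀ =
        (z.1 - z₀.1) • ((1 : ℝ), (0 : ℝ)) + (z.2 - z₀.2) • ((0 : ℝ), (1 : ℝ)) := by
      ext <;> simp
    have hP' : HasFDerivAt P _ z := (hasFDerivAt_fst.sub_const z₀.1).smul hF'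
    have hQ' : HasFDerivAt Q _ z := (hasFDerivAt_snd.sub_const z₀.2).smul hF'
    rw [hP'.fderiv, hQ'.fderiv, hsplit, map_add, map_smul, map_smul]
    simp only [add_apply, smul_apply, ContinuousLinearMap.smulRight_apply,
      ContinuousLinearMap.coe_fst', ContinuousLinearMap.coe_snd', one_smul]
    module
  have hhyp : (∫ τ in (0 : ℝ)..1, P (1 - τ, τ)) + (∫ τ in (0 : ℝ)..1, Q (1 - τ, τ)) =
      (1 - z₀.1 - z₀.2) • ∫ τ in (0 : ℝ)..1, F (1 - τ, τ) := by
    rw [← intervalIntegral.integral_add (Continuous.intervalIntegrable (by fun_prop) _ _)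
      (Continuous.intervalIntegrable (by fun_prop) _ _), ← intervalIntegral.integral_smul]
    refine intervalIntegral.integral_congr fun τ _ => ?_
    simp only [hPdef, hQdef]
    module
  simp only [hdiv]
  rw [integral_add (integrableOn_stdTriangle (by fun_prop))
      (integrableOn_stdTriangle (by fun_prop)),
    setIntegral_stdTriangle_fderiv_fst hP, setIntegral_stdTriangle_fderiv_snd hQ,
    sub_add_sub_comm, hhyp]
  simp only [hPdef, hQdef, intervalIntegral.integral_smul]
  module

end StandardTriangle

section TriangleMap

variable {E : Type*} [AddCommGroup E] [Module ℝ E]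

/-- The weights of the point `z` of the coordinate plane with respect to the vertices `(0, 0)`,
`(1, 0)` and `(0, 1)` of `stdTriangle`. -/
def barycentric (z : ℝ × ℝ) : Fin 3 → ℝ := ![1 - z.1 - z.2, z.1, z.2]

/-- The affine map of the coordinate plane that takes the vertices `(0, 0)`, `(1, 0)` and `(0, 1)`
of `stdTriangle` to `p 0`, `p 1` and `p 2`. -/
def triangleMap (p : Fin 3 → E) (z : ℝ × ℝ) : E := ∑ i, barycentric z i • p i

theorem triangleMap_eq_add (p : Fin 3 → E) (z : ℝ × ℝ) :
    triangleMap p z = p 0 + (z.1 • (p 1 - p 0) + z.2 • (p 2 - p 0)) := by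
  simp only [triangleMap, barycentric, Fin.sum_univ_three, Matrix.cons_val]
  module

theorem triangleMap_sub_triangleMap (p : Fin 3 → E) (z z₀ : ℝ × ℝ) :
    triangleMap p z - triangleMap p z₀ =
      (z.1 - z₀.1) • (p 1 - p 0) + (z.2 - z₀.2) • (p 2 - p 0) := by
  simp only [triangleMap_eq_add]
  module

theorem sub_triangleMap (p : Fin 3 → E) (x : E) (z : ℝ × ℝ) :
    x - triangleMap p z = ∑ i, barycentric z i • (x - p i) := by
  simp only [triangleMap, barycentric, Fin.sum_univ_three, Matrix.cons_val]
  module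

theorem image_barycentric_stdTriangle : barycentric '' stdTriangle = stdSimplex ℝ (Fin 3) := by
  ext w
  constructor
  · rintro ⟨z, ⟨h₁, h₂, h⟩, rfl⟩
    refine ⟨fun i => ?_, ?_⟩
    · fin_cases i
      exacts [show 0 ≤ 1 - z.1 - z.2 by linarith, h₁, h₂]
    · simp only [barycentric, Fin.sum_univ_three, Matrix.cons_val]
      ring
  · rintro ⟨hnonneg, hsum⟩
    rw [Fin.sum_univ_three] at hsum
    refine ⟨(w 1, w 2), ⟨hnonneg 1, hnonneg 2, by linarith [hnonneg 0]⟩, ?_⟩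
    ext i
    fin_cases i
    exacts [show 1 - w 1 - w 2 = w 0 by linarith, rfl, rfl]

theorem image_triangleMap_stdTriangle (p : Fin 3 → E) :
    triangleMap p '' stdTriangle = convexHull ℝ (Set.range p) := by
  have hcomp : triangleMap p = Fintype.linearCombination ℝ p ∘ barycentric := by
    ext z
    rw [Function.comp_apply, Fintype.linearCombination_apply, triangleMap]
  rw [hcomp, Set.image_comp, image_barycentric_stdTriangle,
    ← convexHull_rangle_single_eq_stdSimplex, LinearMap.image_convexHull, ← Set.range_comp]
  simp [Function.comp_def]

end TriangleMap

section RadialProfile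

/-- The solution `g`, smooth on `q > 0`, of `(q - d²) g(q) = (d⁻³ - q ^ (-3/2)) / 3`. For a plane
at distance `d > 0` from `r` and the foot `ρ` of the perpendicular from `r`, the planar vector field
`g(‖x - r‖²) (x - ρ)` has divergence `‖x - r‖⁻⁵`. -/
def radialProfile (d q : ℝ) : ℝ := (1 / (d ^ 3 * (√q * (√q + d))) + 1 / (d ^ 2 * √q ^ 3)) / 3

variable {d q : ℝ}

theorem sub_sq_mul_radialProfile (hd : 0 < d) (hq : 0 < q) :
    (q - d ^ 2) * radialProfile d q = (1 / d ^ 3 - 1 / √q ^ 3) / 3 := by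
  have hsqrt : 0 < √q := Real.sqrt_pos.2 hq
  conv_lhs => rw [← Real.sq_sqrt hq.le, radialProfile, Real.sqrt_sq hsqrt.le]
  field_simp
  ring

theorem contDiffOn_radialProfile {n : WithTop ℕ∞} (hd : 0 < d) :
    ContDiffOn ℝ n (radialProfile d) (Set.Ioi 0) := by
  intro q hq
  have hsqrt : 0 < √q := Real.sqrt_pos.2 hq
  have hsmooth : ContDiffAt ℝ n Real.sqrt q := Real.contDiffAt_sqrt (ne_of_gt hq)
  unfold radialProfile
  refine ContDiffAt.contDiffWithinAt ?_
  fun_prop (disch := positivity)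

theorem differentiableAt_radialProfile (hd : 0 < d) (hq : 0 < q) :
    DifferentiableAt ℝ (radialProfile d) q :=
  ((contDiffOn_radialProfile hd).contDiffAt (Ioi_mem_nhds hq)).differentiableAt one_ne_zero

theorem hasDerivAt_inv_sqrt_pow_three (hq : 0 < q) :
    HasDerivAt (fun q => 1 / √q ^ 3) (-3 / (2 * √q ^ 5)) q := by
  have hsqrt : √q ≠ 0 := (Real.sqrt_pos.2 hq).ne'
  simp only [one_div]
  refine (((Real.hasDerivAt_sqrt hq.ne').fun_pow 3).fun_inv (pow_ne_zero 3 hsqrt)).congr_deriv ?_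
  field_simp
  ring

theorem radialProfile_add_sub_sq_mul_deriv (hd : 0 < d) (hq : 0 < q) :
    radialProfile d q + (q - d ^ 2) * deriv (radialProfile d) q = 1 / (2 * √q ^ 5) := by
  have hprod := ((hasDerivAt_id q).sub_const (d ^ 2)).fun_mul
    (differentiableAt_radialProfile hd hq).hasDerivAt
  have hsolved := ((hasDerivAt_inv_sqrt_pow_three hq).const_sub (1 / d ^ 3)).div_const 3
  have heq := (hsolved.congr_of_eventuallyEq (Filter.eventually_of_mem (Ioi_mem_nhds hq)
    fun x hx => sub_sq_mul_radialProfile hd hx)).unique hprod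
  simp only [id] at heq
  linear_combination -heq

end RadialProfile

section RadialIntegral

variable {E : Type*} [NormedAddCommGroup E] [InnerProductSpace ℝ E]
  {p : Fin 3 → E} {r : E} {z₀ : ℝ × ℝ}

theorem contDiff_triangleMap {n : WithTop ℕ∞} (p : Fin 3 → E) : ContDiff ℝ n (triangleMap p) := by
  rw [funext (triangleMap_eq_add p)]
  fun_prop

theorem hasFDerivAt_triangleMap (p : Fin 3 → E) (z : ℝ × ℝ) :
    HasFDerivAt (triangleMap p)
      ((ContinuousLinearMap.fst ℝ ℝ ℝ).smulRight (p 1 - p 0) +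
        (ContinuousLinearMap.snd ℝ ℝ ℝ).smulRight (p 2 - p 0)) z := by
  rw [funext (triangleMap_eq_add p)]
  exact ((hasFDerivAt_fst.smul_const (p 1 - p 0)).add
    (hasFDerivAt_snd.smul_const (p 2 - p 0))).const_add (p 0)

theorem fderiv_triangleMap_sub (p : Fin 3 → E) (z z₀ : ℝ × ℝ) :
    fderiv ℝ (triangleMap p) z (z - z₀) = triangleMap p z - triangleMap p z₀ := by
  rw [(hasFDerivAt_triangleMap p z).fderiv, triangleMap_sub_triangleMap]
  rfl

theorem inner_triangleMap_sub_foot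
    (hfoot : ∀ i, inner ℝ (p i - triangleMap p z₀) (r - triangleMap p z₀) = 0) (z : ℝ × ℝ) :
    inner ℝ (triangleMap p z - triangleMap p z₀) (r - triangleMap p z₀) = 0 := by
  rw [← neg_sub, inner_neg_left, sub_triangleMap, sum_inner]
  simp only [← neg_sub (p _), smul_neg, inner_neg_left, real_inner_smul_left, hfoot, mul_zero,
    neg_zero, Finset.sum_const_zero]

theorem norm_triangleMap_sub_pos (hr : r ≠ triangleMap p z₀)
    (hfoot : ∀ i, inner ℝ (p i - triangleMap p z₀) (r - triangleMap p z₀) = 0) (z : ℝ × ℝ) :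
    0 < ‖triangleMap p z - r‖ := by
  refine norm_pos_iff.2 (sub_ne_zero.2 ?_)
  rintro rfl
  exact hr (sub_eq_zero.1 (inner_self_eq_zero.1 (inner_triangleMap_sub_foot hfoot z)))

theorem integrableOn_stdTriangle_one_div_norm_sub_pow (hr : r ≠ triangleMap p z₀)
    (hfoot : ∀ i, inner ℝ (p i - triangleMap p z₀) (r - triangleMap p z₀) = 0) (n : ℕ) :
    IntegrableOn (fun z => 1 / ‖triangleMap p z - r‖ ^ n) stdTriangle := by
  have hmap := (contDiff_triangleMap (n := 0) p).continuous
  exact integrableOn_stdTriangle <| continuous_const.div ((hmap.sub continuous_const).norm.pow n)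
    fun z => pow_ne_zero n (norm_triangleMap_sub_pos hr hfoot z).ne'

theorem norm_triangleMap_sub_sq
    (hfoot : ∀ i, inner ℝ (p i - triangleMap p z₀) (r - triangleMap p z₀) = 0) (z : ℝ × ℝ) :
    ‖triangleMap p z - r‖ ^ 2 =
      inner ℝ (triangleMap p z - r) (triangleMap p z - triangleMap p z₀) +
        ‖r - triangleMap p z₀‖ ^ 2 := by
  have hperp := inner_triangleMap_sub_foot hfoot z
  have hpythagoras := norm_sub_sq_real (triangleMap p z - triangleMap p z₀) (r - triangleMap p z₀)
  rw [hperp, sub_sub_sub_cancel_right] at hpythagoras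
  rw [hpythagoras, ← sub_sub_sub_cancel_right _ r (triangleMap p z₀), inner_sub_left,
    real_inner_self_eq_norm_sq, real_inner_comm, hperp, mul_zero]

theorem fderiv_radialProfile_triangleMap (hr : r ≠ triangleMap p z₀)
    (hfoot : ∀ i, inner ℝ (p i - triangleMap p z₀) (r - triangleMap p z₀) = 0) (z : ℝ × ℝ) :
    fderiv ℝ (fun z => radialProfile ‖r - triangleMap p z₀‖ (‖triangleMap p z - r‖ ^ 2)) z
        (z - z₀) =
      2 * ((‖triangleMap p z - r‖ ^ 2 - ‖r - triangleMap p z₀‖ ^ 2) *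
        deriv (radialProfile ‖r - triangleMap p z₀‖) (‖triangleMap p z - r‖ ^ 2)) := by
  have hd : 0 < ‖r - triangleMap p z₀‖ := norm_pos_iff.2 (sub_ne_zero.2 hr)
  have hq := pow_pos (norm_triangleMap_sub_pos hr hfoot z) 2
  have hmap := (hasFDerivAt_triangleMap p z).differentiableAt.hasFDerivAt
  have hcomp := (differentiableAt_radialProfile hd hq).hasDerivAt.comp_hasFDerivAt z
    (hmap.sub_const r).norm_sq
  have hinner := norm_triangleMap_sub_sq hfoot z
  rw [← sub_eq_iff_eq_add] at hinner
  refine (congrArg (fun L => L (z - z₀)) hcomp.fderiv).trans ?_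
  simp only [smul_apply, ContinuousLinearMap.comp_apply, innerSL_apply_apply,
    fderiv_triangleMap_sub, hinner, smul_eq_mul, nsmul_eq_mul, Nat.cast_ofNat]
  ring

theorem two_mul_radialProfile_add_fderiv (hr : r ≠ triangleMap p z₀)
    (hfoot : ∀ i, inner ℝ (p i - triangleMap p z₀) (r - triangleMap p z₀) = 0) (z : ℝ × ℝ) :
    2 * radialProfile ‖r - triangleMap p z₀‖ (‖triangleMap p z - r‖ ^ 2) +
        fderiv ℝ (fun z => radialProfile ‖r - triangleMap p z₀‖ (‖triangleMap p z - r‖ ^ 2)) z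
          (z - z₀) =
      1 / ‖triangleMap p z - r‖ ^ 5 := by
  have hd : 0 < ‖r - triangleMap p z₀‖ := norm_pos_iff.2 (sub_ne_zero.2 hr)
  have hR := norm_triangleMap_sub_pos hr hfoot z
  have hprofile := radialProfile_add_sub_sq_mul_deriv hd (pow_pos hR 2)
  rw [Real.sqrt_sq hR.le] at hprofile
  rw [fderiv_radialProfile_triangleMap hr hfoot, ← mul_add, hprofile]
  field_simp

theorem integral_stdTriangle_one_div_norm_sub_pow_five (hr : r ≠ triangleMap p z₀)
    (hfoot : ∀ i, inner ℝ (p i - triangleMap p z₀) (r - triangleMap p z₀) = 0) :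
    ∫ z in stdTriangle, 1 / ‖triangleMap p z - r‖ ^ 5 =
      ∑ i, barycentric z₀ i * ∫ τ in (0 : ℝ)..1, radialProfile ‖r - triangleMap p z₀‖
        (‖AffineMap.lineMap (p (i + 1)) (p (i - 1)) τ - r‖ ^ 2) := by
  set F : ℝ × ℝ → ℝ :=
    fun z => radialProfile ‖r - triangleMap p z₀‖ (‖triangleMap p z - r‖ ^ 2) with hFdef
  have hF : ContDiff ℝ 1 F := by
    refine (contDiffOn_radialProfile (norm_pos_iff.2 (sub_ne_zero.2 hr))).comp_contDiff
      (((contDiff_triangleMap p).sub contDiff_const).norm_sq ℝ) fun z => ?_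
    exact pow_pos (norm_triangleMap_sub_pos hr hfoot z) 2
  have hside₀ (τ : ℝ) : triangleMap p (1 - τ, τ) = AffineMap.lineMap (p 1) (p 2) τ := by
    rw [triangleMap_eq_add, AffineMap.lineMap_apply_module]
    module
  have hside₁ (τ : ℝ) : triangleMap p (0, 1 - τ) = AffineMap.lineMap (p 2) (p 0) τ := by
    rw [triangleMap_eq_add, AffineMap.lineMap_apply_module]
    module
  have hside₂ (τ : ℝ) : triangleMap p (τ, 0) = AffineMap.lineMap (p 0) (p 1) τ := by
    rw [triangleMap_eq_add, AffineMap.lineMap_apply_module]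
    module
  have hflip := intervalIntegral.integral_comp_sub_left (a := 0) (b := 1) (fun τ => F (0, τ)) 1
  simp only [sub_self, sub_zero] at hflip
  have hdiv := setIntegral_stdTriangle_two_smul_add_fderiv hF z₀
  simp only [hFdef, smul_eq_mul, two_mul_radialProfile_add_fderiv hr hfoot] at hdiv
  rw [hdiv, Fin.sum_univ_three]
  simp only [hFdef] at hflip
  rw [← hflip]
  simp only [hside₀, hside₁, hside₂, barycentric]
  rfl

end RadialIntegral

section AreaFormula

variable {E : Type*} [NormedAddCommGroup E] [InnerProductSpace ℝ E]

/-- The area of the parallelogram spanned by `a` and `b`, as the square root of their Gram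
determinant. -/
def parallelogramArea (a b : E) : ℝ := √(‖a‖ ^ 2 * ‖b‖ ^ 2 - inner ℝ a b ^ 2)

theorem parallelogramArea_nonneg (a b : E) : 0 ≤ parallelogramArea a b := Real.sqrt_nonneg _

theorem normDet_linearCombination (a b : E) :
    (Fintype.linearCombination ℝ ![a, b] ∘ₗ
      (WithLp.linearEquiv 2 ℝ (Fin 2 → ℝ)).toLinearMap).normDet = parallelogramArea a b := by
  set L := Fintype.linearCombination ℝ ![a, b] ∘ₗ (WithLp.linearEquiv 2 ℝ (Fin 2 → ℝ)).toLinearMap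
  have hcolumns (i : Fin 2) : L (EuclideanSpace.basisFun (Fin 2) ℝ i) = ![a, b] i := by simp [L]
  have hgram := L.normDet_sq_eq_det_gram (EuclideanSpace.basisFun (Fin 2) ℝ)
  simp only [Real.ringHom_apply, hcolumns, Matrix.det_fin_two, Matrix.gram_apply,
    Matrix.cons_val_zero, Matrix.cons_val_one, real_inner_self_eq_norm_sq] at hgram
  rw [parallelogramArea, ← Real.sqrt_sq (LinearMap.normDet_nonneg L), hgram, real_inner_comm]
  ring_nf

variable [MeasurableSpace E] [BorelSpace E]

theorem euclideanHausdorffMeasure_image_triangleMap (p : Fin 3 → E) (s : Set (ℝ × ℝ)) :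
    μHE[2] (triangleMap p '' s) =
      ENNReal.ofReal (parallelogramArea (p 1 - p 0) (p 2 - p 0)) * volume s := by
  set L := Fintype.linearCombination ℝ ![p 1 - p 0, p 2 - p 0] ∘ₗ
    (WithLp.linearEquiv 2 ℝ (Fin 2 → ℝ)).toLinearMap with hL
  let e : ℝ × ℝ ≃ᵐ EuclideanSpace ℝ (Fin 2) :=
    MeasurableEquiv.finTwoArrow.symm.trans (MeasurableEquiv.toLp 2 _)
  have he : MeasurePreserving e volume volume :=
    (PiLp.volume_preserving_toLp (Fin 2)).comp ((volume_preserving_finTwoArrow ℝ).symm _)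
  have himage : triangleMap p '' s = (fun x => p 0 + x) '' (L '' (e '' s)) := by
    simp only [← Set.image_comp]
    refine Set.image_congr' fun z => ?_
    simp [triangleMap_eq_add, L, e, Fintype.linearCombination_apply]
  have hmeasure := L.euclideanHausdorffMeasure_image (e '' s)
  rw [finrank_euclideanSpace_fin] at hmeasure
  rw [himage, (isometry_add_left (p 0)).euclideanHausdorffMeasure_image, hmeasure, hL,
    normDet_linearCombination, EuclideanSpace.euclideanHausdorffMeasure_eq_volume,
    e.image_eq_preimage_symm, he.symm.measure_preimage_equiv]

theorem restrict_image_triangleMap (p : Fin 3 → E) (s : Set (ℝ × ℝ)) :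
    (μHE[2]).restrict (triangleMap p '' s) =
      ENNReal.ofReal (parallelogramArea (p 1 - p 0) (p 2 - p 0)) •
        (volume.restrict s).map (triangleMap p) := by
  have hmeas := (contDiff_triangleMap (n := 0) p).continuous.measurable
  ext t ht
  rw [Measure.restrict_apply ht, Measure.smul_apply, Measure.map_apply hmeas ht,
    Measure.restrict_apply (hmeas ht), smul_eq_mul,
    ← euclideanHausdorffMeasure_image_triangleMap p, ← Set.image_preimage_inter, Set.inter_comm]

theorem setIntegral_image_triangleMap {F : Type*} [NormedAddCommGroup F] [NormedSpace ℝ F]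
    (p : Fin 3 → E) {f : E → F} (hf : StronglyMeasurable f) (s : Set (ℝ × ℝ)) :
    ∫ x in triangleMap p '' s, f x ∂μHE[2] =
      parallelogramArea (p 1 - p 0) (p 2 - p 0) • ∫ z in s, f (triangleMap p z) := by
  rw [restrict_image_triangleMap, integral_smul_measure,
    integral_map (contDiff_triangleMap (n := 0) p).continuous.aemeasurable hf.aestronglyMeasurable,
    ENNReal.toReal_ofReal (parallelogramArea_nonneg _ _)]

theorem integrableOn_image_triangleMap {F : Type*} [NormedAddCommGroup F] (p : Fin 3 → E)
    {f : E → F} (hf : StronglyMeasurable f) {s : Set (ℝ × ℝ)}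
    (hint : IntegrableOn (fun z => f (triangleMap p z)) s) :
    IntegrableOn f (triangleMap p '' s) μHE[2] := by
  rw [IntegrableOn, restrict_image_triangleMap]
  exact ((integrable_map_measure hf.aestronglyMeasurable
    (contDiff_triangleMap (n := 0) p).continuous.aemeasurable).2 hint).smul_measure
      ENNReal.ofReal_ne_top

end AreaFormula

section EdgePrimitive

/-- A primitive in `s` of `3 t g(s² + t² + d²)`, where `g` is `radialProfile d`: three times the
flux of `g(‖x - r‖²) (x - ρ)` through a line at signed distance `t` from `ρ`, parametrised by arc
length from the foot of the perpendicular. -/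
def edgePrimitive (d t s : ℝ) : ℝ :=
  Real.arctan (t * s / (t ^ 2 + d ^ 2 + d * √(s ^ 2 + t ^ 2 + d ^ 2))) / d ^ 3 +
    t / d ^ 2 * (1 / (t ^ 2 + d ^ 2) * (s / √(s ^ 2 + t ^ 2 + d ^ 2)))

variable {c d : ℝ}

theorem hasDerivAt_sqrt_sq_add (hc : 0 < c) (s : ℝ) :
    HasDerivAt (fun s => √(s ^ 2 + c)) (s / √(s ^ 2 + c)) s := by
  refine (((hasDerivAt_id s).fun_pow 2).add_const c |>.sqrt (by positivity)).congr_deriv ?_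
  simp only [id, Nat.cast_ofNat, Nat.add_one_sub_one, pow_one, mul_one]
  exact mul_div_mul_left _ _ two_ne_zero

theorem hasDerivAt_div_sqrt_sq_add (hc : 0 < c) (s : ℝ) :
    HasDerivAt (fun s => s / √(s ^ 2 + c)) (c / √(s ^ 2 + c) ^ 3) s := by
  have hR : 0 < √(s ^ 2 + c) := by positivity
  have hsq : √(s ^ 2 + c) ^ 2 = s ^ 2 + c := Real.sq_sqrt (by positivity)
  refine ((hasDerivAt_id s).fun_div (hasDerivAt_sqrt_sq_add hc s) hR.ne').congr_deriv ?_
  simp only [id]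
  field_simp
  linear_combination hsq

theorem hasDerivAt_arctan_div_add_mul_sqrt (hd : 0 < d) (t s : ℝ) :
    HasDerivAt (fun s => Real.arctan (t * s / (t ^ 2 + d ^ 2 + d * √(s ^ 2 + (t ^ 2 + d ^ 2)))))
      (t / (√(s ^ 2 + (t ^ 2 + d ^ 2)) * (√(s ^ 2 + (t ^ 2 + d ^ 2)) + d))) s := by
  have hc : 0 < t ^ 2 + d ^ 2 := by positivity
  have hR : 0 < √(s ^ 2 + (t ^ 2 + d ^ 2)) := by positivity
  have hsq : √(s ^ 2 + (t ^ 2 + d ^ 2)) ^ 2 = s ^ 2 + (t ^ 2 + d ^ 2) :=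
    Real.sq_sqrt (by positivity)
  have hden : 0 < t ^ 2 + d ^ 2 + d * √(s ^ 2 + (t ^ 2 + d ^ 2)) := by positivity
  refine (((hasDerivAt_id s).const_mul t).fun_div
    (((hasDerivAt_sqrt_sq_add hc s).const_mul d).const_add (t ^ 2 + d ^ 2))
      hden.ne').arctan.congr_deriv ?_
  simp only [id, mul_one]
  generalize √(s ^ 2 + (t ^ 2 + d ^ 2)) = R at hR hsq hden ⊢
  have hsum : (t ^ 2 + d ^ 2 + d * R) ^ 2 + (t * s) ^ 2 = (t ^ 2 + d ^ 2) * (R + d) ^ 2 := by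
    linear_combination (-t ^ 2) * hsq
  have hone_add : 1 + (t * s / (t ^ 2 + d ^ 2 + d * R)) ^ 2 =
      (t ^ 2 + d ^ 2) * (R + d) ^ 2 / (t ^ 2 + d ^ 2 + d * R) ^ 2 := by
    rw [← hsum]
    field_simp
  have hnum : t * (t ^ 2 + d ^ 2 + d * R) - t * s * (d * (s / R)) =
      t * (t ^ 2 + d ^ 2) * (R + d) / R := by
    field_simp
    linear_combination t * d * hsq
  rw [hone_add, hnum]
  field_simp

theorem hasDerivAt_edgePrimitive (hd : 0 < d) (t s : ℝ) :
    HasDerivAt (edgePrimitive d t) (3 * (t * radialProfile d (s ^ 2 + t ^ 2 + d ^ 2))) s := by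
  have hc : 0 < t ^ 2 + d ^ 2 := by positivity
  unfold edgePrimitive radialProfile
  simp only [add_assoc (_ ^ 2) (t ^ 2) (d ^ 2)]
  refine (((hasDerivAt_arctan_div_add_mul_sqrt hd t s).div_const (d ^ 3)).add
    (((hasDerivAt_div_sqrt_sq_add hc s).const_mul (1 / (t ^ 2 + d ^ 2))).const_mul
      (t / d ^ 2))).congr_deriv ?_
  field_simp

theorem continuous_radialProfile_sq_add (hd : 0 < d) (t : ℝ) :
    Continuous fun s => radialProfile d (s ^ 2 + t ^ 2 + d ^ 2) :=
  (contDiffOn_radialProfile (n := 0) hd).continuousOn.comp_continuous (by fun_prop)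
    fun s => show 0 < s ^ 2 + t ^ 2 + d ^ 2 by positivity

theorem mul_integral_radialProfile (hd : 0 < d) (t a b : ℝ) :
    t * ∫ s in a..b, radialProfile d (s ^ 2 + t ^ 2 + d ^ 2) =
      (edgePrimitive d t b - edgePrimitive d t a) / 3 := by
  have hftc := intervalIntegral.integral_eq_sub_of_hasDerivAt (a := a) (b := b)
    (fun s _ => hasDerivAt_edgePrimitive hd t s)
    (Continuous.intervalIntegrable
      (((continuous_radialProfile_sq_add hd t).const_mul t).const_mul 3) _ _)
  rw [← hftc, intervalIntegral.integral_const_mul, intervalIntegral.integral_const_mul]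
  ring

theorem mul_mul_integral_radialProfile_comp (hd : 0 < d) (t σ l : ℝ) :
    t * l * ∫ τ in (0 : ℝ)..1, radialProfile d ((σ + l * τ) ^ 2 + t ^ 2 + d ^ 2) =
      (edgePrimitive d t (σ + l) - edgePrimitive d t σ) / 3 := by
  have hsubst := intervalIntegral.mul_integral_comp_add_mul (a := 0) (b := 1)
    (f := fun s => radialProfile d (s ^ 2 + t ^ 2 + d ^ 2)) l σ
  rw [mul_zero, add_zero, mul_one] at hsubst
  rw [mul_assoc, hsubst, mul_integral_radialProfile hd]

end EdgePrimitive

section CrossProduct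

theorem inner_eq_dotProduct (a b : E3) : inner ℝ a b = a.ofLp ⬝ᵥ b.ofLp := by
  rw [EuclideanSpace.inner_eq_star_dotProduct, star_trivial, dotProduct_comm]

theorem inner_cross_cross (a b x y : E3) :
    inner ℝ (cross a b) (cross x y) =
      inner ℝ a x * inner ℝ b y - inner ℝ a y * inner ℝ b x := by
  simp only [inner_eq_dotProduct, cross, cross_dot_cross]

theorem inner_left_cross (a b : E3) : inner ℝ a (cross a b) = 0 := by
  rw [inner_eq_dotProduct, cross, dot_self_cross]

theorem inner_right_cross (a b : E3) : inner ℝ b (cross a b) = 0 := by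
  rw [inner_eq_dotProduct, cross, dot_cross_self]

theorem inner_cross_comm (a b x : E3) : inner ℝ x (cross a b) = inner ℝ b (cross x a) := by
  simp only [inner_eq_dotProduct, cross]
  exact (triple_product_permutation _ _ _).symm

theorem norm_cross (a b : E3) : ‖cross a b‖ = parallelogramArea a b := by
  rw [parallelogramArea, ← Real.sqrt_sq (norm_nonneg (cross a b)), ← real_inner_self_eq_norm_sq,
    inner_cross_cross, real_inner_self_eq_norm_sq, real_inner_self_eq_norm_sq,
    real_inner_comm a b, ← sq]

theorem cross_smul_left (c : ℝ) (a b : E3) : cross (c • a) b = c • cross a b := by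
  rw [cross, WithLp.ofLp_smul, map_smul, LinearMap.smul_apply]
  rfl

theorem cross_smul_right (c : ℝ) (a b : E3) : cross a (c • b) = c • cross a b := by
  rw [cross, WithLp.ofLp_smul, map_smul]
  rfl

theorem cross_sub_right (a b x : E3) : cross a (b - x) = cross a b - cross a x := by
  rw [cross, WithLp.ofLp_sub, map_sub]
  rfl

theorem cross_cross (a b x : E3) :
    cross a (cross b x) = inner ℝ a x • b - inner ℝ b a • x := by
  simp only [cross, inner_eq_dotProduct, cross_cross_eq_smul_sub_smul', WithLp.toLp_sub,
    WithLp.toLp_smul, WithLp.toLp_ofLp]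

theorem cross_cross_right (a b x : E3) :
    cross (cross a b) x = inner ℝ a x • b - inner ℝ b x • a := by
  simp only [cross, inner_eq_dotProduct, cross_cross_eq_smul_sub_smul, WithLp.toLp_sub,
    WithLp.toLp_smul, WithLp.toLp_ofLp]

/-- Cramer's rule in the basis `a`, `b`, `cross a b`. -/
theorem norm_cross_sq_smul (a b x : E3) :
    ‖cross a b‖ ^ 2 • x =
      inner ℝ (cross x b) (cross a b) • a + inner ℝ (cross a x) (cross a b) • b +
        inner ℝ x (cross a b) • cross a b := by
  have htriple := cross_cross (cross a b) x (cross a b)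
  rw [cross_cross x a b, cross_sub_right, cross_smul_right, cross_smul_right, cross_cross_right,
    cross_cross_right, eq_sub_iff_add_eq, real_inner_self_eq_norm_sq (cross a b)] at htriple
  rw [← htriple, inner_cross_cross, inner_cross_cross, real_inner_comm a b, real_inner_comm a x]
  module

theorem exists_smul_add_smul_eq {a b x : E3} (hab : cross a b ≠ 0)
    (hx : inner ℝ x (cross a b) = 0) : ∃ u v : ℝ, u • a + v • b = x := by
  have hnorm : ‖cross a b‖ ^ 2 ≠ 0 := by positivity
  have hcramer := norm_cross_sq_smul a b x
  rw [hx, zero_smul, add_zero, ← eq_inv_smul_iff₀ hnorm, smul_add, smul_smul, smul_smul] at hcramer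
  exact ⟨_, _, hcramer.symm⟩

theorem norm_sq_eq_add_of_orthonormal {s n : E3} (hs : ‖s‖ = 1) (hn : ‖n‖ = 1)
    (hsn : inner ℝ s n = 0) (x : E3) :
    ‖x‖ ^ 2 = inner ℝ x s ^ 2 + inner ℝ x (cross s n) ^ 2 + inner ℝ x n ^ 2 := by
  have hnorm : ‖cross s n‖ ^ 2 = 1 := by
    rw [← real_inner_self_eq_norm_sq, inner_cross_cross, real_inner_self_eq_norm_sq,
      real_inner_self_eq_norm_sq, hs, hn, hsn]
    norm_num
  have hcramer := congrArg (inner ℝ x) (norm_cross_sq_smul s n x)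
  simp only [hnorm, inner_cross_cross, inner_add_right, real_inner_smul_right,
    real_inner_self_eq_norm_sq, real_inner_comm s n, hs, hn, hsn] at hcramer
  linear_combination hcramer

end CrossProduct

section Triangle

theorem norm_unit {a : E3} (ha : a ≠ 0) : ‖unit a‖ = 1 := by
  rw [unit, norm_smul, norm_inv, norm_norm, inv_mul_cancel₀ (norm_ne_zero_iff.2 ha)]

theorem norm_smul_unit (a : E3) : ‖a‖ • unit a = a := by
  rcases eq_or_ne a 0 with rfl | ha
  · rw [norm_zero, zero_smul]
  · exact smul_inv_smul₀ (norm_ne_zero_iff.2 ha) a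

variable (T : Affine.Triangle ℝ E3) (r0 : E3) (i : Fin 3)

/-- The normal of the plane of the triangle whose length is twice the area of the triangle. -/
def normal : E3 := cross (edge T 0) (edge T 1)

theorem wHat_eq_unit_normal : wHat T = unit (normal T) := rfl

theorem cross_edge_sub_one_edge : cross (edge T (i - 1)) (edge T i) = normal T := by
  have hsum : edge T 2 = -(edge T 0 + edge T 1) := by
    simp only [edge, Fin.reduceSub, Fin.reduceAdd]
    abel
  fin_cases i
  · change cross (edge T 2) (edge T 0) = _
    rw [hsum]
    simp [cross, normal]
  · rfl
  · change cross (edge T 1) (edge T 2) = _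
    rw [hsum]
    simp [cross, normal]

theorem cross_points_sub_points_zero :
    cross (T.points 1 - T.points 0) (T.points 2 - T.points 0) = normal T := by
  have hfst : T.points 1 - T.points 0 = edge T 2 := rfl
  have hsnd : T.points 2 - T.points 0 = -edge T 1 := (neg_sub _ _).symm
  rw [hfst, hsnd, ← cross_edge_sub_one_edge T 2, cross, WithLp.ofLp_neg, map_neg, cross_anticomm]
  rfl

theorem normal_ne_zero : normal T ≠ 0 := by
  have hcol := (affineIndependent_iff_not_collinear_of_ne (i₁ := 1) (i₂ := 0) (i₃ := 2)
    (by decide) (by decide) (by decide)).1 T.independent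
  have hsin := EuclideanGeometry.sin_ne_zero_of_not_collinear hcol
  rw [EuclideanGeometry.angle, vsub_eq_sub, vsub_eq_sub] at hsin
  rw [← cross_points_sub_points_zero, ← norm_ne_zero_iff, cross,
    InnerProductGeometry.norm_ofLp_crossProduct]
  have hne {i : Fin 3} (hi : i ≠ 0) : ‖T.points i - T.points 0‖ ≠ 0 :=
    norm_ne_zero_iff.2 (sub_ne_zero.2 (T.independent.injective.ne hi))
  exact mul_ne_zero (mul_ne_zero (hne (by decide)) (hne (by decide))) hsin

theorem edge_ne_zero : edge T i ≠ 0 :=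
  sub_ne_zero.2 (T.independent.injective.ne (by fin_cases i <;> decide))

theorem inner_edge_normal : inner ℝ (edge T i) (normal T) = 0 := by
  rw [← cross_edge_sub_one_edge T i, inner_right_cross]

theorem inner_edge_wHat : inner ℝ (edge T i) (wHat T) = 0 := by
  rw [wHat_eq_unit_normal, unit, real_inner_smul_right, inner_edge_normal, mul_zero]

theorem inner_points_sub_wHat : inner ℝ (T.points i - r0) (wHat T) = w0 T r0 := by
  have hside : inner ℝ (T.points i - T.points 0) (wHat T) = 0 := by
    fin_cases i
    · simp
    · exact inner_edge_wHat T 2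
    · rw [← neg_sub, inner_neg_left, neg_eq_zero]
      exact inner_edge_wHat T 1
  rw [w0, ← sub_add_sub_cancel _ (T.points 0), inner_add_left, hside, zero_add]

theorem norm_wHat : ‖wHat T‖ = 1 := norm_unit (normal_ne_zero T)

theorem norm_rho_sub : ‖r0 - rho T r0‖ = |w0 T r0| := by
  rw [rho, sub_add_cancel_left, norm_neg, norm_smul, norm_wHat, mul_one, Real.norm_eq_abs]

theorem inner_points_sub_rho_wHat : inner ℝ (T.points i - rho T r0) (wHat T) = 0 := by
  rw [rho, ← sub_sub, inner_sub_left, inner_points_sub_wHat, real_inner_smul_left,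
    real_inner_self_eq_norm_sq, norm_wHat, one_pow, mul_one, sub_self]

theorem inner_points_sub_rho_sub_rho :
    inner ℝ (T.points i - rho T r0) (r0 - rho T r0) = 0 := by
  have hheight : r0 - rho T r0 = -(w0 T r0 • wHat T) := by rw [rho, sub_add_cancel_left]
  rw [hheight, inner_neg_right, real_inner_smul_right, inner_points_sub_rho_wHat, mul_zero,
    neg_zero]

theorem exists_triangleMap_eq_rho : ∃ z₀, triangleMap T.points z₀ = rho T r0 := by
  have hperp : inner ℝ (rho T r0 - T.points 0) (normal T) = 0 := by
    rw [← norm_smul_unit (normal T), ← wHat_eq_unit_normal, real_inner_smul_right, ← neg_sub,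
      inner_neg_left, inner_points_sub_rho_wHat, neg_zero, mul_zero]
  rw [← cross_points_sub_points_zero] at hperp
  obtain ⟨u, v, huv⟩ := exists_smul_add_smul_eq
    (cross_points_sub_points_zero T ▸ normal_ne_zero T) hperp
  exact ⟨(u, v), by rw [triangleMap_eq_add, huv, add_sub_cancel]⟩

theorem points_add_one_sub_triangleMap (z : ℝ × ℝ) :
    T.points (i + 1) - triangleMap T.points z =
      barycentric z i • edge T (i - 1) - barycentric z (i - 1) • edge T i := by
  rw [sub_triangleMap, Fin.sum_univ_three]
  fin_cases i
  all_goals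
    simp only [edge, Fin.zero_eta, Fin.mk_one, Fin.reduceFinMk, Fin.reduceAdd, Fin.reduceSub]
    module

theorem t0_mul_norm_edge {z₀ : ℝ × ℝ} (hz₀ : triangleMap T.points z₀ = rho T r0) :
    t0 T r0 i * ‖edge T i‖ = ‖normal T‖ * barycentric z₀ i := by
  have hunit : inner ℝ (wHat T) (normal T) = ‖normal T‖ := by
    conv_lhs => rw [← norm_smul_unit (normal T), ← wHat_eq_unit_normal]
    rw [real_inner_smul_right, real_inner_self_eq_norm_sq, norm_wHat, one_pow, mul_one]
  have hcross : cross (T.points (i + 1) - rho T r0) (edge T i) = barycentric z₀ i • normal T := by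
    rw [← hz₀, points_add_one_sub_triangleMap, ← cross_edge_sub_one_edge T i]
    simp [cross]
  rw [t0, mHat, mul_comm, ← real_inner_smul_right, ← cross_smul_left, sHat, norm_smul_unit,
    inner_cross_comm, hcross, real_inner_smul_right, hunit, mul_comm]

theorem norm_sHat : ‖sHat T i‖ = 1 := norm_unit (edge_ne_zero T i)

theorem inner_edge_sHat : inner ℝ (edge T i) (sHat T i) = ‖edge T i‖ := by
  rw [← norm_smul_unit (edge T i), ← sHat, real_inner_smul_left, real_inner_self_eq_norm_sq,
    norm_sHat, norm_smul, norm_norm, norm_sHat]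
  norm_num

theorem inner_sHat_wHat : inner ℝ (sHat T i) (wHat T) = 0 := by
  rw [sHat, unit, real_inner_smul_left, inner_edge_wHat, mul_zero]

theorem inner_edge_mHat : inner ℝ (edge T i) (mHat T i) = 0 := by
  rw [← norm_smul_unit (edge T i), ← sHat, real_inner_smul_left, mHat, inner_left_cross, mul_zero]

theorem sPlus_eq : sPlus T r0 i = sMinus T r0 i + ‖edge T i‖ := by
  rw [← inner_edge_sHat, sPlus, sMinus, ← inner_add_left]
  congr 1
  rw [edge]
  abel

theorem norm_lineMap_sub_sq (τ : ℝ) :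
    ‖AffineMap.lineMap (T.points (i + 1)) (T.points (i - 1)) τ - r0‖ ^ 2 =
      (sMinus T r0 i + ‖edge T i‖ * τ) ^ 2 + t0 T r0 i ^ 2 + |w0 T r0| ^ 2 := by
  have hpoint : AffineMap.lineMap (T.points (i + 1)) (T.points (i - 1)) τ - r0 =
      (T.points (i + 1) - rho T r0) + τ • edge T i + w0 T r0 • wHat T := by
    rw [AffineMap.lineMap_apply_module, edge, rho]
    module
  have hs : inner ℝ (wHat T) (sHat T i) = 0 := (real_inner_comm _ _).trans (inner_sHat_wHat T i)
  have hm : inner ℝ (wHat T) (mHat T i) = 0 := inner_right_cross _ _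
  rw [norm_sq_eq_add_of_orthonormal (norm_sHat T i) (norm_wHat T) (inner_sHat_wHat T i), ← mHat,
    hpoint]
  simp only [inner_add_left, real_inner_smul_left, inner_edge_sHat, inner_edge_mHat,
    inner_edge_wHat, inner_points_sub_rho_wHat, hs, hm, real_inner_self_eq_norm_sq, norm_wHat]
  rw [← sMinus, ← t0, sq_abs]
  ring

theorem edgePrimitive_sPlus_sub_sMinus :
    edgePrimitive |w0 T r0| (t0 T r0 i) (sPlus T r0 i) -
        edgePrimitive |w0 T r0| (t0 T r0 i) (sMinus T r0 i) =
      betaEdge T r0 i / |w0 T r0| ^ 3 + t0 T r0 i / w0 T r0 ^ 2 * Rs T r0 i := by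
  have hR0 : R0 T r0 i ^ 2 = t0 T r0 i ^ 2 + w0 T r0 ^ 2 := Real.sq_sqrt (by positivity)
  simp only [edgePrimitive, betaEdge, Rs, hR0, RPlus, RMinus, sq_abs]
  ring

variable {r0} in
theorem t0_mul_norm_edge_mul_integral_radialProfile (hw : w0 T r0 ≠ 0) :
    t0 T r0 i * ‖edge T i‖ * ∫ τ in (0 : ℝ)..1, radialProfile |w0 T r0|
        (‖AffineMap.lineMap (T.points (i + 1)) (T.points (i - 1)) τ - r0‖ ^ 2) =
      (betaEdge T r0 i / |w0 T r0| ^ 3 + t0 T r0 i / w0 T r0 ^ 2 * Rs T r0 i) / 3 := by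
  simp only [norm_lineMap_sub_sq]
  rw [mul_mul_integral_radialProfile_comp (abs_pos.2 hw), ← sPlus_eq,
    edgePrimitive_sPlus_sub_sMinus]

end Triangle

end TriangleIntegral

end

open TriangleIntegral in
/-- `μHE[2]` is surface measure: two-dimensional Hausdorff measure normalised to agree with
Lebesgue measure on planes. -/
theorem mainTheorem3 (T : Affine.Triangle ℝ TriangleIntegral.E3) (r0 : TriangleIntegral.E3)
    (hw : TriangleIntegral.w0 T r0 ≠ 0) :
    IntegrableOn (fun r : TriangleIntegral.E3 => 1 / ‖r - r0‖ ^ 5)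
        (TriangleIntegral.region T) μHE[2] ∧
      ∫ r in TriangleIntegral.region T, 1 / ‖r - r0‖ ^ 5 ∂μHE[2] =
        1 / 3 * (TriangleIntegral.beta T r0 / |TriangleIntegral.w0 T r0| ^ 3 +
          ∑ i : Fin 3, TriangleIntegral.t0 T r0 i / TriangleIntegral.w0 T r0 ^ 2 *
            TriangleIntegral.Rs T r0 i) := by
  obtain ⟨z₀, hz₀⟩ := exists_triangleMap_eq_rho T r0
  have hr : r0 ≠ triangleMap T.points z₀ := by
    rw [hz₀, ← sub_ne_zero, ← norm_ne_zero_iff, norm_rho_sub]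
    exact abs_ne_zero.2 hw
  have hfoot (i : Fin 3) :
      inner ℝ (T.points i - triangleMap T.points z₀) (r0 - triangleMap T.points z₀) = 0 := by
    rw [hz₀, inner_points_sub_rho_sub_rho]
  have hmeas : StronglyMeasurable fun r : E3 => 1 / ‖r - r0‖ ^ 5 :=
    Measurable.stronglyMeasurable (by fun_prop)
  rw [region, ← image_triangleMap_stdTriangle]
  refine ⟨integrableOn_image_triangleMap _ hmeas
    (integrableOn_stdTriangle_one_div_norm_sub_pow hr hfoot 5), ?_⟩
  rw [setIntegral_image_triangleMap _ hmeas, ← norm_cross, cross_points_sub_points_zero,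
    integral_stdTriangle_one_div_norm_sub_pow_five hr hfoot, hz₀, norm_rho_sub, smul_eq_mul,
    Finset.mul_sum]
  simp only [← mul_assoc, ← t0_mul_norm_edge T r0 _ hz₀,
    t0_mul_norm_edge_mul_integral_radialProfile T _ hw]
  rw [← Finset.sum_div, Finset.sum_add_distrib, ← Finset.sum_div, ← beta, div_eq_inv_mul, one_div]
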